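/- A mechanism for selling $k$ items to a single additive buyer with valuation $x\in\mathbb{R}_+^k$ is a pair of measurable functions $q:\mathbb{R}_+^k\to[0,1]^k$ (allocation probabilities) and $s:\mathbb{R}_+^k\to\mathbb{R}$ (payment). It is incentive compatible if $x\cdot q(x)-s(x)\ge x\cdot q(x')-s(x')$ for all $x,x'\in\mathbb{R}_+^k$, and individually rational if $x\cdot q(x)-s(x)\ge 0$ for all $x\in\mathbb{R}_+^k$. For a probability distribution $\mathcal{F}$ on $\mathbb{R}_+^k$, let $\mathrm{Rev}_k(\mathcal{F})\in[0,\infty]$ be the supremum of $\mathbb{E}_{x\sim\mathcal{F}}[s(x)]$ over all incentive compatible and individually rational mechanisms $(q,s)$ for $k$ items. There exists a constant $c>0$ such that for every integer $k\ge 2$ and all probability distributions $F_1,\dots,F_k$ on $\mathbb{R}_+$, $$\mathrm{Rev}_1(F_1)+\cdots+\mathrm{Rev}_1(F_k)\;\ge\;\frac{c}{\log^2 k}\cdot\mathrm{Rev}_k(F_1\times\cdots\times F_k),$$ where $F_1\times\cdots\times F_k$ is the product distribution and $\log$ is the natural logarithm. -/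

import Mathlib

open MeasureTheory
open scoped NNReal ENNReal

/-- A direct mechanism for selling the items of a finite set `ι` to a single buyer. A valuation is
a vector `x : ι → ℝ≥0`; at the reported valuation `x` item `i` is allocated with probability
`q x i`, and the buyer makes the expected payment `s x` (a real number of either sign).
Measurability makes the expected payment meaningful. -/
structure Mechanism (ι : Type*) where
  q : (ι → ℝ≥0) → ι → ℝ
  s : (ι → ℝ≥0) → ℝ
  q_nonneg : ∀ x i, 0 ≤ q x i
  q_le_one : ∀ x i, q x i ≤ 1
  measurable_q : Measurable q
  measurable_s : Measurable s

namespace Mechanism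

variable {ι : Type*} [Fintype ι]

/-- Utility of a buyer with true valuation `x` who reports `y`. -/
def utility (M : Mechanism ι) (x y : ι → ℝ≥0) : ℝ :=
  ∑ i, (x i : ℝ) * M.q y i - M.s y

/-- Ex-post individual rationality. -/
def IsIR (M : Mechanism ι) : Prop :=
  ∀ x, 0 ≤ M.utility x x

/-- Incentive compatibility. -/
def IsIC (M : Mechanism ι) : Prop :=
  ∀ x y, M.utility x y ≤ M.utility x x

/-- Expected payment when the valuation has law `μ`, as an extended real: the expectation of the
positive part minus the expectation of the negative part. For an incentive compatible mechanism
`s` is bounded below by `s 0`, so for a probability measure the second term is finite. -/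
noncomputable def revenue (M : Mechanism ι) (μ : Measure (ι → ℝ≥0)) : EReal :=
  ((∫⁻ x, ENNReal.ofReal (M.s x) ∂μ : ℝ≥0∞) : EReal) -
    ((∫⁻ x, ENNReal.ofReal (-M.s x) ∂μ : ℝ≥0∞) : EReal)

end Mechanism

/-- The optimal revenue from a buyer with valuation of law `μ`: the supremum of the expected
payment over all incentive compatible and individually rational mechanisms. -/
noncomputable def Rev {ι : Type*} [Fintype ι] (μ : Measure (ι → ℝ≥0)) : EReal :=
  ⨆ (M : Mechanism ι) (_ : M.IsIC) (_ : M.IsIR), M.revenue μ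

/-- The optimal revenue from a single item whose value has law `F`. -/
noncomputable def Rev₁ (F : Measure ℝ≥0) : EReal :=
  Rev (F.map (fun (x : ℝ≥0) (_ : Fin 1) => x))

/-! Let `R` be the sum of the single-item revenues. Fixing all reports but the `i`-th and refunding
the other items received leaves a single-item mechanism, so the payment is at most a single-item
payment for `i` plus the other values (`payment_le_normalizedPayment_add`). Take `i` to be a most
valuable item. The single-item payments, being nonnegative, can be summed over all `i`, costing `R`
in expectation.

What remains is the value of the non-maximal items. Posted prices give `t * F i [t, ∞) ≤ Rev₁ (F
i)`; integrating this tail from `R / k` to `R` bounds the values truncated at `R` by `R + R log k`.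
A non-maximal value above `R` is matched by another item; by independence such values cost another
`R` (`lintegral_matched_tail_le`). The total `(3 + log k) R` is stronger than the `log² k` bound
required. -/

/-! ### Single-item revenue and truncated means. -/

/-- A single-item mechanism with nonnegative payments earns at most `Rev₁`. -/
theorem lintegral_payment_le_Rev₁ (F : Measure ℝ≥0) (q s : ℝ≥0 → ℝ)
    (hq : Measurable q) (hs : Measurable s) (hq0 : ∀ x, 0 ≤ q x) (hq1 : ∀ x, q x ≤ 1)
    (hs0 : ∀ x, 0 ≤ s x) (hIR : ∀ x : ℝ≥0, 0 ≤ x * q x - s x)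
    (hIC : ∀ x y : ℝ≥0, x * q y - s y ≤ x * q x - s x) :
    ((∫⁻ x, ENNReal.ofReal (s x) ∂F : ℝ≥0∞) : EReal) ≤ Rev₁ F := by
  let M : Mechanism (Fin 1) :=
    { q := fun x _ => q (x 0)
      s := fun x => s (x 0)
      q_nonneg := fun x _ => hq0 _
      q_le_one := fun x _ => hq1 _
      measurable_q := by fun_prop
      measurable_s := by fun_prop }
  have hM1 : M.IsIC := fun x y => by simpa [Mechanism.utility, M] using hIC (x 0) (y 0)
  have hM2 : M.IsIR := fun x => by simpa [Mechanism.utility, M] using hIR (x 0)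
  have hmeas : Measurable (fun (x : ℝ≥0) (_ : Fin 1) => x) := by fun_prop
  have hrev : M.revenue (F.map fun (x : ℝ≥0) (_ : Fin 1) => x)
      = ((∫⁻ x, ENNReal.ofReal (s x) ∂F : ℝ≥0∞) : EReal) := by
    have hneg : ∀ x, ENNReal.ofReal (-M.s x) = 0 := fun x =>
      ENNReal.ofReal_of_nonpos (by simpa [M] using hs0 (x 0))
    rw [Mechanism.revenue, lintegral_map (M.measurable_s.ennreal_ofReal) hmeas]
    simp [hneg, M]
  rw [← hrev]
  exact le_iSup_of_le M (le_iSup_of_le hM1 (le_iSup_of_le hM2 le_rfl))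

theorem Rev₁_nonneg (F : Measure ℝ≥0) : 0 ≤ Rev₁ F := by
  simpa using lintegral_payment_le_Rev₁ F (fun _ => 0) (fun _ => 0) measurable_const
    measurable_const (by simp) (by simp) (by simp) (by simp) (by simp)

/-- Posting the price `t` sells with probability `F (Ici t)`. -/
theorem mul_measure_Ici_le_Rev₁ (F : Measure ℝ≥0) (t : ℝ≥0) :
    t * F (Set.Ici t) ≤ (Rev₁ F).toENNReal := by
  have h := lintegral_payment_le_Rev₁ F (fun x => if t ≤ x then 1 else 0)
    (fun x => if t ≤ x then (t : ℝ) else 0)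
    (Measurable.ite measurableSet_Ici measurable_const measurable_const)
    (Measurable.ite measurableSet_Ici measurable_const measurable_const)
    (fun x => by split_ifs <;> simp) (fun x => by split_ifs <;> simp)
    (fun x => by split_ifs <;> simp)
    (fun x => by
      split_ifs with h
      · have : (t : ℝ) ≤ x := h
        linarith
      · simp)
    (fun x y => by
      split_ifs with h1 h2 h2
      · simp
      · have : (x : ℝ) < t := not_le.mp h2
        linarith
      · have : (t : ℝ) ≤ x := h2
        linarith
      · simp)
  have h2 := EReal.toENNReal_le_toENNReal h
  rw [EReal.toENNReal_coe] at h2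
  refine le_trans (le_of_eq ?_) h2
  rw [← lintegral_indicator_const measurableSet_Ici]
  refine lintegral_congr fun x => ?_
  by_cases hx : t ≤ x <;> simp [hx]

/-- Truncated first moment of a law whose tail is at most `r / t`. -/
theorem lintegral_min_le (F : Measure ℝ≥0) [IsProbabilityMeasure F] (r : ℝ≥0∞)
    (hr : ∀ t : ℝ≥0, t * F (Set.Ici t) ≤ r) (a b : ℝ) (ha : 0 < a) (hab : a ≤ b) :
    ∫⁻ x, ENNReal.ofReal (min (x : ℝ) b) ∂F
      ≤ ENNReal.ofReal a + r * ENNReal.ofReal (Real.log (b / a)) := by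
  have hS : MeasurableSet {p : ℝ≥0 × ℝ | p.2 ≤ p.1} :=
    measurableSet_le measurable_snd (by fun_prop)
  -- Layer cake: levels below `a` contribute at most `a`; each level `t` in `(a, b]` counts when `t
  -- ≤ x`.
  have hpt : ∀ x : ℝ≥0, ENNReal.ofReal (min (x : ℝ) b) ≤ ENNReal.ofReal a +
      ∫⁻ t in Set.Ioc a b, {p : ℝ≥0 × ℝ | p.2 ≤ p.1}.indicator (fun _ => (1 : ℝ≥0∞)) (x, t) := by
    intro x
    have h1 : ∫⁻ t in Set.Ioc a b,
        {p : ℝ≥0 × ℝ | p.2 ≤ p.1}.indicator (fun _ => (1 : ℝ≥0∞)) (x, t)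
        = ENNReal.ofReal (min b x - a) := by
      have : ∀ t : ℝ, {p : ℝ≥0 × ℝ | p.2 ≤ p.1}.indicator (fun _ => (1 : ℝ≥0∞)) (x, t)
          = (Set.Iic (x : ℝ)).indicator (fun _ => 1) t := fun t => rfl
      simp_rw [this]
      rw [lintegral_indicator_const measurableSet_Iic, one_mul,
        Measure.restrict_apply measurableSet_Iic, Set.inter_comm, Set.Ioc_inter_Iic,
        Real.volume_Ioc]
    rw [h1, min_comm]
    calc ENNReal.ofReal (min b x) = ENNReal.ofReal (a + (min b x - a)) := by ring_nf
      _ ≤ _ := ENNReal.ofReal_add_le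
  have htail : ∀ t ∈ Set.Ioc a b,
      ∫⁻ x, {p : ℝ≥0 × ℝ | p.2 ≤ p.1}.indicator (fun _ => (1 : ℝ≥0∞)) (x, t) ∂F
        ≤ r * ENNReal.ofReal t⁻¹ := by
    intro t ht
    have ht0 : 0 < t := ha.trans ht.1
    lift t to ℝ≥0 using ht0.le
    have : ∀ x : ℝ≥0, {p : ℝ≥0 × ℝ | p.2 ≤ p.1}.indicator (fun _ => (1 : ℝ≥0∞)) (x, (t : ℝ))
        = (Set.Ici t).indicator (fun _ => 1) x := fun x => by
      by_cases h : t ≤ x <;> simp [h]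
    simp_rw [this]
    rw [lintegral_indicator_const measurableSet_Ici, one_mul, ENNReal.ofReal_inv_of_pos ht0,
      ENNReal.ofReal_coe_nnreal, ← div_eq_mul_inv]
    have ht' : (t : ℝ≥0∞) ≠ 0 := by
      have : (t : ℝ) ≠ 0 := ht0.ne'
      exact_mod_cast this
    rw [ENNReal.le_div_iff_mul_le (Or.inl ht') (Or.inl ENNReal.coe_ne_top), mul_comm]
    exact hr t
  have hlog : ∫⁻ t in Set.Ioc a b, ENNReal.ofReal t⁻¹ = ENNReal.ofReal (Real.log (b / a)) := by
    rw [← integral_inv_of_pos ha (ha.trans_le hab), intervalIntegral.integral_of_le hab,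
      ofReal_integral_eq_lintegral_ofReal]
    · have : IntervalIntegrable (fun t : ℝ => t⁻¹) volume a b :=
        intervalIntegral.intervalIntegrable_inv (fun x hx => by
          rw [Set.uIcc_of_le hab] at hx
          exact (ha.trans_le hx.1).ne') continuousOn_id
      exact (intervalIntegrable_iff_integrableOn_Ioc_of_le hab).mp this
    · filter_upwards [ae_restrict_mem measurableSet_Ioc] with t ht
      exact inv_nonneg.mpr (ha.trans ht.1).le
  calc ∫⁻ x, ENNReal.ofReal (min (x : ℝ) b) ∂F
      ≤ ∫⁻ x, (ENNReal.ofReal a + ∫⁻ t in Set.Ioc a b,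
          {p : ℝ≥0 × ℝ | p.2 ≤ p.1}.indicator (fun _ => (1 : ℝ≥0∞)) (x, t)) ∂F :=
        lintegral_mono hpt
    _ = ENNReal.ofReal a + ∫⁻ t in Set.Ioc a b, ∫⁻ x,
          {p : ℝ≥0 × ℝ | p.2 ≤ p.1}.indicator (fun _ => (1 : ℝ≥0∞)) (x, t) ∂F := by
        rw [lintegral_add_left measurable_const, lintegral_const, measure_univ, mul_one,
          lintegral_lintegral_swap]
        exact (measurable_const.indicator hS).aemeasurable
    _ ≤ ENNReal.ofReal a + ∫⁻ t in Set.Ioc a b, r * ENNReal.ofReal t⁻¹ := by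
        gcongr 1
        exact setLIntegral_mono' measurableSet_Ioc htail
    _ = _ := by rw [lintegral_const_mul _ (by fun_prop), hlog]

theorem lintegral_pi_eval {ι : Type*} [Fintype ι] (F : ι → Measure ℝ≥0)
    [∀ i, IsProbabilityMeasure (F i)] (i : ι)
    (f : ℝ≥0 → ℝ≥0∞) (hf : Measurable f) :
    ∫⁻ x, f (x i) ∂Measure.pi F = ∫⁻ t, f t ∂F i :=
  (measurePreserving_eval F i).lintegral_comp hf

/-- The sum of the values truncated at `R`, when the single-item revenues sum to `R`. -/
theorem sum_lintegral_min_le {ι : Type*} [Fintype ι] [Nonempty ι] (F : ι → Measure ℝ≥0)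
    [∀ i, IsProbabilityMeasure (F i)] (R : ℝ≥0)
    (hR : ∑ i, (Rev₁ (F i)).toENNReal = R) :
    ∑ j, ∫⁻ t, ENNReal.ofReal (min (t : ℝ) R) ∂F j
      ≤ R + R * ENNReal.ofReal (Real.log (Fintype.card ι)) := by
  rcases eq_or_ne R 0 with rfl | hR0
  · simp
  have hRpos : (0 : ℝ) < R := by exact_mod_cast pos_iff_ne_zero.mpr hR0
  have hk : (1 : ℝ) ≤ Fintype.card ι := by exact_mod_cast Fintype.card_pos (α := ι)
  have hk0 : (0 : ℝ) < Fintype.card ι := by linarith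
  have hdiv : (R : ℝ) / (R / Fintype.card ι) = Fintype.card ι := by field_simp
  calc ∑ j, ∫⁻ t, ENNReal.ofReal (min (t : ℝ) R) ∂F j
      ≤ ∑ j, (ENNReal.ofReal (R / Fintype.card ι)
        + (Rev₁ (F j)).toENNReal * ENNReal.ofReal (Real.log (Fintype.card ι))) := by
        refine Finset.sum_le_sum fun j _ => ?_
        -- The lower cutoff `R / k` makes the `k` constant terms add up to `R`, with log factor `log
        -- k`.
        have := lintegral_min_le (F j) _ (mul_measure_Ici_le_Rev₁ (F j)) (R / Fintype.card ι) R
          (by positivity) (div_le_self hRpos.le hk)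
        rwa [hdiv] at this
    _ = R + R * ENNReal.ofReal (Real.log (Fintype.card ι)) := by
        rw [Finset.sum_add_distrib, ← Finset.sum_mul, hR, Finset.sum_const, Finset.card_univ,
          ← ENNReal.ofReal_nsmul, nsmul_eq_mul, mul_div_cancel₀ _ hk0.ne',
          ENNReal.ofReal_coe_nnreal]

theorem measurable_matched_tail {ι : Type*} (R : ℝ≥0) (i j : ι) :
    Measurable fun x : ι → ℝ≥0 => if R ≤ x j ∧ x j ≤ x i then (x j : ℝ≥0∞) else 0 := by
  have h1 : MeasurableSet {x : ι → ℝ≥0 | R ≤ x j} :=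
    measurableSet_le measurable_const (measurable_pi_apply j)
  have h2 : MeasurableSet {x : ι → ℝ≥0 | x j ≤ x i} :=
    measurableSet_le (measurable_pi_apply j) (measurable_pi_apply i)
  exact Measurable.ite (h1.inter h2) (by fun_prop) measurable_const

/-! ### Product laws and marginal mechanisms. -/

section Product

variable {ι : Type*} [Fintype ι] [DecidableEq ι]

/-- Resampling one coordinate does not change a product law. -/
theorem lintegral_pi_update {α : ι → Type*} [∀ i, MeasurableSpace (α i)]
    (F : ∀ i, Measure (α i)) [∀ i, IsProbabilityMeasure (F i)] (i : ι)
    (f : (∀ i, α i) → ℝ≥0∞) (hf : Measurable f) :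
    ∫⁻ x, f x ∂Measure.pi F
      = ∫⁻ x, ∫⁻ t, f (Function.update x i t) ∂F i ∂Measure.pi F := by
  have hg : Measurable fun p : (∀ i, α i) × α i => Function.update p.1 i p.2 := by
    refine measurable_pi_lambda _ fun j => ?_
    by_cases h : j = i
    · subst h
      simpa using measurable_snd
    · simpa [h, Function.comp_def] using
        (measurable_pi_apply (X := α) j).comp (measurable_fst (β := α i))
  have hmap : ((Measure.pi F).prod (F i)).map
      (fun p : (∀ i, α i) × α i => Function.update p.1 i p.2) = Measure.pi F := by
    refine (Measure.pi_eq fun s hs => ?_).symm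
    rw [Measure.map_apply hg (MeasurableSet.univ_pi hs)]
    have : (fun p : (∀ i, α i) × α i => Function.update p.1 i p.2) ⁻¹' (Set.univ.pi s)
        = (Set.univ.pi (Function.update s i Set.univ)) ×ˢ s i := by
      ext p
      simp only [Set.mem_preimage, Set.mem_pi, Set.mem_univ, true_implies, Set.mem_prod]
      constructor
      · intro h
        refine ⟨fun j => ?_, by simpa using h i⟩
        by_cases hj : j = i
        · subst hj; simp
        · simpa [hj] using h j
      · rintro ⟨h, h'⟩ j
        by_cases hj : j = i
        · subst hj; simpa using h'
        · simpa [hj] using h j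
    rw [this, Measure.prod_prod, Measure.pi_pi, ← Finset.mul_prod_erase _ _ (Finset.mem_univ i),
      ← Finset.mul_prod_erase _ (fun i => F i (s i)) (Finset.mem_univ i), Function.update_self,
      measure_univ, one_mul, mul_comm]
    congr 1
    refine Finset.prod_congr rfl fun j hj => ?_
    rw [Function.update_of_ne (Finset.ne_of_mem_erase hj)]
  conv_lhs => rw [← hmap]
  rw [lintegral_map hf hg, lintegral_prod (fun p => f (Function.update p.1 i p.2)) (hf.comp hg).aemeasurable]

namespace Mechanism

/-- The payment for item `i` in the single-item mechanism obtained by fixing the other reports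
and refunding the value of the other items received. -/
noncomputable def marginalPayment (M : Mechanism ι) (i : ι) (x : ι → ℝ≥0) : ℝ :=
  M.s x - ∑ j ∈ Finset.univ.erase i, (x j : ℝ) * M.q x j

/-- The marginal payment, shifted so that it vanishes at value `0`. -/
noncomputable def normalizedPayment (M : Mechanism ι) (i : ι) (x : ι → ℝ≥0) : ℝ :=
  M.marginalPayment i x - M.marginalPayment i (Function.update x i 0)

theorem measurable_marginalPayment (M : Mechanism ι) (i : ι) :
    Measurable (M.marginalPayment i) := by
  have hs := M.measurable_s
  have hq : ∀ j, Measurable fun x => M.q x j := fun j =>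
    (measurable_pi_apply j).comp M.measurable_q
  unfold marginalPayment
  fun_prop

theorem measurable_normalizedPayment (M : Mechanism ι) (i : ι) :
    Measurable (M.normalizedPayment i) := by
  have h := M.measurable_marginalPayment i
  have hu : Measurable fun x : ι → ℝ≥0 => Function.update x i 0 := by fun_prop
  exact h.sub (h.comp hu)

theorem utility_update (M : Mechanism ι) (i : ι) (x : ι → ℝ≥0) (t u : ℝ≥0) :
    M.utility (Function.update x i t) (Function.update x i u)
      = t * M.q (Function.update x i u) i - M.marginalPayment i (Function.update x i u) := by
  rw [utility, marginalPayment, ← Finset.add_sum_erase _ _ (Finset.mem_univ i),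
    Function.update_self]
  have : ∀ v : ℝ≥0, ∑ j ∈ Finset.univ.erase i,
      (Function.update x i v j : ℝ) * M.q (Function.update x i u) j
      = ∑ j ∈ Finset.univ.erase i, (x j : ℝ) * M.q (Function.update x i u) j := fun v =>
    Finset.sum_congr rfl fun j hj => by rw [Function.update_of_ne (Finset.ne_of_mem_erase hj)]
  rw [this, this]
  ring

/-- A buyer with value `0` for item `i` has utility minus the marginal payment, so truthful
reporting minimizes that payment. -/
theorem marginalPayment_update_zero_le (M : Mechanism ι) (hIC : M.IsIC) (i : ι) (x : ι → ℝ≥0)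
    (t : ℝ≥0) :
    M.marginalPayment i (Function.update x i 0) ≤ M.marginalPayment i (Function.update x i t) := by
  have h := hIC (Function.update x i 0) (Function.update x i t)
  rw [utility_update, utility_update] at h
  simpa using h

theorem marginalPayment_update_zero_nonpos (M : Mechanism ι) (hIR : M.IsIR) (i : ι)
    (x : ι → ℝ≥0) : M.marginalPayment i (Function.update x i 0) ≤ 0 := by
  have h := hIR (Function.update x i 0)
  rw [utility_update] at h
  simpa using h

theorem normalizedPayment_nonneg (M : Mechanism ι) (hIC : M.IsIC) (i : ι) (x : ι → ℝ≥0) :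
    0 ≤ M.normalizedPayment i x := by
  have h := M.marginalPayment_update_zero_le hIC i x (x i)
  rw [Function.update_eq_self] at h
  exact sub_nonneg.mpr h

theorem payment_le_normalizedPayment_add (M : Mechanism ι) (hIR : M.IsIR) (i : ι)
    (x : ι → ℝ≥0) :
    M.s x ≤ M.normalizedPayment i x + ∑ j ∈ Finset.univ.erase i, (x j : ℝ) := by
  have h := M.marginalPayment_update_zero_nonpos hIR i x
  have h2 : ∑ j ∈ Finset.univ.erase i, (x j : ℝ) * M.q x j
      ≤ ∑ j ∈ Finset.univ.erase i, (x j : ℝ) :=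
    Finset.sum_le_sum fun j _ => mul_le_of_le_one_right (x j).2 (M.q_le_one x j)
  have h3 : M.marginalPayment i x
      = M.s x - ∑ j ∈ Finset.univ.erase i, (x j : ℝ) * M.q x j := rfl
  rw [normalizedPayment]
  linarith

/-- The normalizing shift depends only on the other reports, so incentive compatibility survives it.
-/
theorem lintegral_normalizedPayment_update_le (M : Mechanism ι) (hIC : M.IsIC) (i : ι)
    (F : Measure ℝ≥0) (x : ι → ℝ≥0) :
    ∫⁻ t, ENNReal.ofReal (M.normalizedPayment i (Function.update x i t)) ∂F
      ≤ (Rev₁ F).toENNReal := by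
  have hup : Measurable fun t : ℝ≥0 => Function.update x i t := measurable_update x
  have hpay : ∀ t, M.normalizedPayment i (Function.update x i t)
      = M.marginalPayment i (Function.update x i t)
        - M.marginalPayment i (Function.update x i 0) := fun t => by
    rw [normalizedPayment, Function.update_idem]
  have h := lintegral_payment_le_Rev₁ F (fun t => M.q (Function.update x i t) i)
    (fun t => M.normalizedPayment i (Function.update x i t))
    ((measurable_pi_apply i).comp (M.measurable_q.comp hup))
    ((M.measurable_normalizedPayment i).comp hup) (fun t => M.q_nonneg _ _)
    (fun t => M.q_le_one _ _) (fun t => M.normalizedPayment_nonneg hIC i _)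
    -- Individual rationality: after the shift, reporting `0` costs nothing, so truth-telling yields
    -- at least `t` times a probability.
    (fun t => by
      have h1 := hIC (Function.update x i t) (Function.update x i 0)
      rw [utility_update, utility_update] at h1
      have h2 := mul_nonneg t.2 (M.q_nonneg (Function.update x i 0) i)
      rw [hpay]
      simp only [NNReal.val_eq_coe] at h2
      linarith)
    (fun t u => by
      have h1 := hIC (Function.update x i t) (Function.update x i u)
      rw [utility_update, utility_update] at h1
      rw [hpay, hpay]
      linarith)
  simpa using EReal.toENNReal_le_toENNReal h

/-- Charge the payment to the marginal payment for a most valuable item, the truncated values, and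
the values above `R` that are not the strict maximum. -/
theorem ofReal_payment_le [Nonempty ι] (M : Mechanism ι) (hIR : M.IsIR)
    (R : ℝ≥0) (x : ι → ℝ≥0) :
    ENNReal.ofReal (M.s x) ≤ ∑ i, ENNReal.ofReal (M.normalizedPayment i x)
      + ∑ j, ENNReal.ofReal (min (x j : ℝ) R)
      + ∑ j, ∑ i ∈ Finset.univ.erase j, if R ≤ x j ∧ x j ≤ x i then (x j : ℝ≥0∞) else 0 := by
  obtain ⟨m, -, hm⟩ := Finset.exists_max_image Finset.univ x Finset.univ_nonempty
  have hval : ∀ j ∈ Finset.univ.erase m, (x j : ℝ≥0∞) ≤ ENNReal.ofReal (min (x j : ℝ) R)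
      + ∑ i ∈ Finset.univ.erase j, if R ≤ x j ∧ x j ≤ x i then (x j : ℝ≥0∞) else 0 := by
    intro j hj
    rcases le_total R (x j) with h | h
    · refine le_add_left (le_trans ?_ (Finset.single_le_sum (fun _ _ => zero_le)
        (Finset.mem_erase.mpr ⟨(Finset.ne_of_mem_erase hj).symm, Finset.mem_univ m⟩)))
      rw [if_pos ⟨h, hm j (Finset.mem_univ j)⟩]
    · refine le_add_right ?_
      rw [min_eq_left (by exact_mod_cast h), ENNReal.ofReal_coe_nnreal]
  calc ENNReal.ofReal (M.s x)
      ≤ ENNReal.ofReal (M.normalizedPayment m x + ∑ j ∈ Finset.univ.erase m, (x j : ℝ)) :=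
        ENNReal.ofReal_le_ofReal (M.payment_le_normalizedPayment_add hIR m x)
    _ ≤ ENNReal.ofReal (M.normalizedPayment m x) + ∑ j ∈ Finset.univ.erase m, (x j : ℝ≥0∞) := by
        refine ENNReal.ofReal_add_le.trans ?_
        rw [ENNReal.ofReal_sum_of_nonneg fun j _ => NNReal.coe_nonneg _]
        simp
    _ ≤ ∑ i, ENNReal.ofReal (M.normalizedPayment i x) +
          ∑ j ∈ Finset.univ.erase m, (ENNReal.ofReal (min (x j : ℝ) R)
      + ∑ i ∈ Finset.univ.erase j, if R ≤ x j ∧ x j ≤ x i then (x j : ℝ≥0∞) else 0) :=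
        add_le_add (Finset.single_le_sum (f := fun i => ENNReal.ofReal (M.normalizedPayment i x))
          (fun _ _ => zero_le) (Finset.mem_univ m)) (Finset.sum_le_sum hval)
    _ ≤ _ := by
        rw [add_assoc, ← Finset.sum_add_distrib]
        gcongr
        exact Finset.subset_univ _

end Mechanism

/-! ### Bounding the expected terms and conclusion. -/

/-- The expected value of item `j` where it is at least `R` and some item `i ≠ j` matches it. -/
theorem lintegral_matched_tail_le (F : ι → Measure ℝ≥0) [∀ i, IsProbabilityMeasure (F i)]
    (R : ℝ≥0) (i j : ι) (hij : i ≠ j) :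
    ∫⁻ x, (if R ≤ x j ∧ x j ≤ x i then (x j : ℝ≥0∞) else 0) ∂Measure.pi F
      ≤ (Rev₁ (F i)).toENNReal * F j (Set.Ici R) := by
  -- With the other coordinates fixed, resampling `x i` turns the integrand into the revenue from
  -- posting price `x j` for item `i`.
  rw [lintegral_pi_update F i _ (measurable_matched_tail R i j), ← lintegral_indicator_const measurableSet_Ici,
    ← lintegral_pi_eval F j _ (measurable_const.indicator measurableSet_Ici)]
  refine lintegral_mono fun x => ?_
  simp only [Function.update_self, Function.update_of_ne hij.symm]
  by_cases h : R ≤ x j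
  · have : ∀ t, (if R ≤ x j ∧ x j ≤ t then (x j : ℝ≥0∞) else 0)
        = (Set.Ici (x j)).indicator (fun _ => (x j : ℝ≥0∞)) t := fun t => by
      by_cases ht : x j ≤ t <;> simp [h, ht]
    simp_rw [this]
    rw [lintegral_indicator_const measurableSet_Ici,
      Set.indicator_of_mem (show x j ∈ Set.Ici R from h)]
    exact mul_measure_Ici_le_Rev₁ (F i) (x j)
  · simp [h]

/-- Selling separately loses at most a factor `3 + log k`. -/
theorem Rev_pi_le [Nonempty ι] (F : ι → Measure ℝ≥0) [∀ i, IsProbabilityMeasure (F i)] (R : ℝ≥0)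
    (hR : ∑ i, (Rev₁ (F i)).toENNReal = R) :
    Rev (Measure.pi F)
      ≤ ((R * ENNReal.ofReal (3 + Real.log (Fintype.card ι)) : ℝ≥0∞) : EReal) := by
  refine iSup_le fun M => iSup_le fun hIC => iSup_le fun hIR => ?_
  have hsub : M.revenue (Measure.pi F)
      ≤ ((∫⁻ x, ENNReal.ofReal (M.s x) ∂Measure.pi F : ℝ≥0∞) : EReal) := by
    rw [Mechanism.revenue]
    exact (EReal.sub_le_sub le_rfl (EReal.coe_ennreal_nonneg _)).trans_eq (sub_zero _)
  refine hsub.trans (EReal.coe_ennreal_le_coe_ennreal_iff.mpr ?_)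
  have hm1 : ∀ i, Measurable fun x => ENNReal.ofReal (M.normalizedPayment i x) := fun i =>
    (M.measurable_normalizedPayment i).ennreal_ofReal
  have hm2 : ∀ j, Measurable fun x : ι → ℝ≥0 => ENNReal.ofReal (min (x j : ℝ) R) := fun j => by
    fun_prop
  have hm3 : ∀ j i, Measurable fun x : ι → ℝ≥0 =>
      if R ≤ x j ∧ x j ≤ x i then (x j : ℝ≥0∞) else 0 := fun j i =>
    measurable_matched_tail R i j
  have h1 : ∑ i, ∫⁻ x, ENNReal.ofReal (M.normalizedPayment i x) ∂Measure.pi F ≤ R := by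
    rw [← hR]
    refine Finset.sum_le_sum fun i _ => ?_
    rw [lintegral_pi_update F i _ (hm1 i)]
    refine (lintegral_mono fun x =>
      M.lintegral_normalizedPayment_update_le hIC i (F i) x).trans ?_
    simp
  have h2 : ∑ j, ∫⁻ x, ENNReal.ofReal (min (x j : ℝ) R) ∂Measure.pi F
      ≤ R + R * ENNReal.ofReal (Real.log (Fintype.card ι)) := by
    refine le_trans (le_of_eq ?_) (sum_lintegral_min_le F R hR)
    exact Finset.sum_congr rfl fun j _ =>
      lintegral_pi_eval F j (fun t => ENNReal.ofReal (min (t : ℝ) R)) (by fun_prop)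
  have h3 : ∑ j, ∑ i ∈ Finset.univ.erase j,
      ∫⁻ x, (if R ≤ x j ∧ x j ≤ x i then (x j : ℝ≥0∞) else 0) ∂Measure.pi F ≤ R := by
    -- For fixed `j`, summing over `i` gives `R * F j [R, ∞)`, the revenue from posting price `R`
    -- for item `j`.
    conv_rhs => rw [← hR]
    refine Finset.sum_le_sum fun j _ => ?_
    calc ∑ i ∈ Finset.univ.erase j,
        ∫⁻ x, (if R ≤ x j ∧ x j ≤ x i then (x j : ℝ≥0∞) else 0) ∂Measure.pi F
        ≤ ∑ i ∈ Finset.univ.erase j, (Rev₁ (F i)).toENNReal * F j (Set.Ici R) :=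
          Finset.sum_le_sum fun i hi =>
            lintegral_matched_tail_le F R i j (Finset.ne_of_mem_erase hi)
      _ ≤ ∑ i, (Rev₁ (F i)).toENNReal * F j (Set.Ici R) :=
          Finset.sum_le_sum_of_subset (Finset.subset_univ _)
      _ = R * F j (Set.Ici R) := by rw [← Finset.sum_mul, hR]
      _ ≤ (Rev₁ (F j)).toENNReal := mul_measure_Ici_le_Rev₁ (F j) R
  have hlog : 0 ≤ Real.log (Fintype.card ι) := Real.log_natCast_nonneg _
  calc ∫⁻ x, ENNReal.ofReal (M.s x) ∂Measure.pi F
      ≤ _ := lintegral_mono fun x => M.ofReal_payment_le hIR R x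
    _ = ∑ i, ∫⁻ x, ENNReal.ofReal (M.normalizedPayment i x) ∂Measure.pi F
        + ∑ j, ∫⁻ x, ENNReal.ofReal (min (x j : ℝ) R) ∂Measure.pi F
        + ∑ j, ∑ i ∈ Finset.univ.erase j,
          ∫⁻ x, (if R ≤ x j ∧ x j ≤ x i then (x j : ℝ≥0∞) else 0) ∂Measure.pi F := by
        have hs1 := Finset.measurable_sum Finset.univ fun i _ => hm1 i
        have hs2 := Finset.measurable_sum Finset.univ fun j _ => hm2 j
        rw [lintegral_add_left (by fun_prop), lintegral_add_left (by fun_prop),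
          lintegral_finsetSum _ fun i _ => hm1 i, lintegral_finsetSum _ fun j _ => hm2 j,
          lintegral_finsetSum _ fun j _ => Finset.measurable_fun_sum _ fun i _ => hm3 j i]
        congr 1
        exact Finset.sum_congr rfl fun j _ => lintegral_finsetSum _ fun i _ => hm3 j i
    _ ≤ R + (R + R * ENNReal.ofReal (Real.log (Fintype.card ι))) + R := by gcongr
    _ = R * ENNReal.ofReal (3 + Real.log (Fintype.card ι)) := by
        rw [ENNReal.ofReal_add (by norm_num) hlog]
        norm_num
        ring

end Product

/-- With `L = log k`, `10 L² - L - 3 = (5 L - 3)(2 L + 1)`, and `L ≥ log 2 > 3/5`. -/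
theorem three_add_log_le {k : ℕ} (hk : 2 ≤ k) :
    3 + Real.log k ≤ 10 * Real.log k ^ 2 := by
  have h1 : Real.log 2 ≤ Real.log k :=
    Real.log_le_log (by norm_num) (by exact_mod_cast hk)
  have h2 := Real.log_two_gt_d9
  nlinarith

theorem theorem3 :
    ∃ c : ℝ, 0 < c ∧
      ∀ (k : ℕ), 2 ≤ k →
        ∀ (F : Fin k → Measure ℝ≥0), (∀ i, IsProbabilityMeasure (F i)) →
          ((c / Real.log (k : ℝ) ^ 2 : ℝ) : EReal) * Rev (Measure.pi F) ≤ ∑ i, Rev₁ (F i) := by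
  refine ⟨1 / 10, by norm_num, fun k hk F hF => ?_⟩
  have hsum : ∑ i, Rev₁ (F i) = ((∑ i, (Rev₁ (F i)).toENNReal : ℝ≥0∞) : EReal) := by
    have hcoe : ((∑ i, (Rev₁ (F i)).toENNReal : ℝ≥0∞) : EReal)
        = ∑ i, (((Rev₁ (F i)).toENNReal : ℝ≥0∞) : EReal) :=
      map_sum (⟨⟨((↑) : ℝ≥0∞ → EReal), EReal.coe_ennreal_zero⟩, EReal.coe_ennreal_add⟩ :
        ℝ≥0∞ →+ EReal) _ _
    rw [hcoe]
    exact Finset.sum_congr rfl fun i _ => (EReal.coe_toENNReal (Rev₁_nonneg (F i))).symm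
  rw [hsum]
  rcases eq_or_ne (∑ i, (Rev₁ (F i)).toENNReal) ⊤ with htop | hfin
  · rw [htop]
    exact le_top
  lift ∑ i, (Rev₁ (F i)).toENNReal to ℝ≥0 using hfin with R hR
  have : Nonempty (Fin k) := ⟨⟨0, by omega⟩⟩
  have hrev := Rev_pi_le F R hR.symm
  rw [Fintype.card_fin] at hrev
  have hlog : 0 < Real.log k := Real.log_pos (by exact_mod_cast hk)
  have hc : 0 ≤ 1 / 10 / Real.log k ^ 2 := by positivity
  have hc' : (0 : EReal) ≤ ((1 / 10 / Real.log k ^ 2 : ℝ) : EReal) := by exact_mod_cast hc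
  refine (mul_le_mul_of_nonneg_left hrev hc').trans ?_
  have h3 : (0 : ℝ) ≤ 3 + Real.log k := by positivity
  rw [← ENNReal.ofReal_coe_nnreal, ← ENNReal.ofReal_mul R.coe_nonneg, EReal.coe_ennreal_ofReal,
    EReal.coe_ennreal_ofReal, max_eq_left (mul_nonneg R.coe_nonneg h3), max_eq_left R.coe_nonneg, ← EReal.coe_mul,
    EReal.coe_le_coe_iff]
  have h4 := mul_le_mul_of_nonneg_left (three_add_log_le hk) R.coe_nonneg
  have h5 : 0 < Real.log k ^ 2 := by positivity
  rw [div_div, div_mul_eq_mul_div, one_mul, div_le_iff₀ (by positivity)]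
  linarith
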